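/- Let $n\ge 2$ and $N$ be integers with $n+1\le N\le 2n$, and let $\mathbb{S}^{n-1}$ be the unit sphere of $\mathbb{R}^n$ with surface area measure $\mu$. A finite set $C\subset\mathbb{S}^{n-1}$ is a *spherical $\tau$-design* if $$\frac{1}{\mu(\mathbb{S}^{n-1})}\int_{\mathbb{S}^{n-1}} f\,d\mu=\frac{1}{|C|}\sum_{x\in C}f(x)$$ for every real polynomial $f(x_1,\dots,x_n)$ of total degree at most $\tau$. Let $h:[-1,1]\to[0,+\infty]$ be absolutely monotone, meaning that $h$ is finite and infinitely differentiable on $[-1,1)$ (one-sidedly at $-1$) with $h^{(k)}(t)\ge 0$ for all $k\ge 0$ and $t\in[-1,1)$. Put $$\mathcal{L}(n,N,\tau;h):=\inf\Big\{\sum_{x,y\in C,\ x\ne y}h(\langle x,y\rangle)\;:\;C\subset\mathbb{S}^{n-1}\text{ is a spherical }\tau\text{-design with }|C|=N\Big\}\in[0,+\infty],$$ the sum being over ordered pairs of distinct points, with $\inf\emptyset=+\infty$. Then $$\mathcal{L}(n,N,2;h)\ \ge\ \frac{N\,[\,h(0)N(N-n-1)+n\,h(1-N/n)\,]}{N-n}.$$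 In particular, with $\zeta:=N/n$, $$\mathcal{L}(n,N,2;h)\ \ge\ h(0)N^2+\frac{N\,[\,h(1-\zeta)-\zeta h(0)\,]}{\zeta-1}.$$ -/

import Mathlib

open scoped ENNReal

namespace SphericalEnergy

/-- The unit sphere `S^{n-1}` of Euclidean space `ℝⁿ`. -/
abbrev UnitSphere (n : ℕ) : Type :=
  Metric.sphere (0 : EuclideanSpace ℝ (Fin n)) 1

/-- The surface area measure on `S^{n-1}`. -/
noncomputable def surfaceMeasure (n : ℕ) : MeasureTheory.Measure (UnitSphere n) :=
  (MeasureTheory.volume : MeasureTheory.Measure (EuclideanSpace ℝ (Fin n))).toSphere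

/-- The value of a polynomial in `n` variables at a point of `S^{n-1}`. -/
noncomputable def evalOn {n : ℕ} (f : MvPolynomial (Fin n) ℝ) (x : UnitSphere n) : ℝ :=
  MvPolynomial.eval (fun i => (x : EuclideanSpace ℝ (Fin n)) i) f

/-- A finite set `C ⊆ S^{n-1}` is a spherical `τ`-design if, for every polynomial `f` of total
degree at most `τ`, the average of `f` over the sphere equals the average of `f` over `C`. -/
def IsSphericalDesign {n : ℕ} (τ : ℕ) (C : Finset (UnitSphere n)) : Prop :=
  ∀ f : MvPolynomial (Fin n) ℝ, f.totalDegree ≤ τ →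
    ((surfaceMeasure n).real Set.univ)⁻¹ * ∫ x, evalOn f x ∂(surfaceMeasure n)
      = (C.card : ℝ)⁻¹ * ∑ x ∈ C, evalOn f x

open Classical in
/-- The `h`-energy of `C`: the sum of `h ⟨x, y⟩` over all ordered pairs of distinct points of `C`.
Only the values of `h` on `[-1, 1]` matter. -/
noncomputable def energy {n : ℕ} (h : ℝ → ℝ≥0∞) (C : Finset (UnitSphere n)) : ℝ≥0∞ :=
  ∑ p ∈ C.offDiag,
    h (inner ℝ (p.1 : EuclideanSpace ℝ (Fin n)) (p.2 : EuclideanSpace ℝ (Fin n)))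

/-- `𝓛(n, N, τ; h)`: the infimum of the `h`-energies of the spherical `τ`-designs
`C ⊆ S^{n-1}` with exactly `N` points (`+∞` if there is no such design). -/
noncomputable def minDesignEnergy (n N τ : ℕ) (h : ℝ → ℝ≥0∞) : ℝ≥0∞ :=
  ⨅ C ∈ {C : Finset (UnitSphere n) | C.card = N ∧ IsSphericalDesign τ C}, energy h C

/-- An extended real-valued potential `h : [-1, 1] → [0, +∞]` is absolutely monotone if it is
finite on `[-1, 1)`, smooth there (one-sidedly at `-1`), and all its derivatives of order
`k ≥ 0` are nonnegative on `[-1, 1)`. The value `h 1` may be `+∞`. -/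
def IsAbsolutelyMonotone (h : ℝ → ℝ≥0∞) : Prop :=
  (∀ t ∈ Set.Ico (-1 : ℝ) 1, h t ≠ ∞) ∧
    AbsolutelyMonotoneOn (fun t => (h t).toReal) (Set.Ico (-1 : ℝ) 1)

end SphericalEnergy

/-! ### Quadratic Hermite minorants of absolutely monotone functions. -/

namespace SphericalEnergy

/-! This is the linear programming method. Put `s = 1 - N/n`; the bounds on `N` say exactly that `-1
≤ s < 0`. Distinct points of a 2-design have inner products in `[s, 1)`
(`IsSphericalDesign.le_inner`). On that interval `h` dominates the quadratic `p(t) = h(0) + b t + c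
t²` that meets it at `s` and is tangent to it at `0`
(`exists_quadratic_le_of_absolutelyMonotoneOn`), because `h'` is convex. The first two moments of a
2-design fix the sum of `p` over its pairs (`IsSphericalDesign.sum_offDiag_quadratic`): it is
`N((N-1)h(0) - b - cs)`. Since `bs + cs² = h(s) - h(0)`, the slope at `0` drops out and the stated
bound remains. -/

theorem absolutelyMonotoneOn_mono {f : ℝ → ℝ} {s t : Set ℝ} (hf : AbsolutelyMonotoneOn f s)
    (hts : t ⊆ s) : AbsolutelyMonotoneOn f t := by
  obtain ⟨p, hp, hp0⟩ := hf
  exact ⟨p, hp.mono hts, fun n x hx => hp0 n (hts hx)⟩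

/-- On an open interval the derivative of an absolutely monotone function is convex. -/
theorem convexOn_deriv_of_absolutelyMonotoneOn {f : ℝ → ℝ} {a b : ℝ}
    (hf : AbsolutelyMonotoneOn f (Set.Ioo a b)) : ConvexOn ℝ (Set.Ioo a b) (deriv f) := by
  have hc := hf.contDiffOn
  have h1 : ContDiffOn ℝ (⊤ : ℕ∞) (deriv f) (Set.Ioo a b) := hc.deriv_of_isOpen isOpen_Ioo le_rfl
  have h2 : ContDiffOn ℝ (⊤ : ℕ∞) (deriv (deriv f)) (Set.Ioo a b) :=
    h1.deriv_of_isOpen isOpen_Ioo le_rfl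
  refine convexOn_of_deriv2_nonneg (convex_Ioo a b) h1.continuousOn ?_ ?_ ?_
  · rw [interior_Ioo]
    exact h1.differentiableOn (by simp)
  · rw [interior_Ioo]
    exact h2.differentiableOn (by simp)
  · rw [interior_Ioo]
    intro x hx
    have h3 := hf.iteratedDerivWithin_nonneg isOpen_Ioo.uniqueDiffOn 3 hx
    rwa [iteratedDerivWithin_of_isOpen_eq_iterate isOpen_Ioo hx] at h3

/-- If the derivative of `ψ` is convex and vanishes at `0`, and `ψ` vanishes at `0` and at some
`s < 0`, then `ψ` is nonnegative to the right of `s`. -/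
theorem nonneg_of_convexOn_deriv {ψ ψ' : ℝ → ℝ} {s b : ℝ} (hs : s < 0) (hb : 0 < b)
    (hcont : ContinuousOn ψ (Set.Ico s b))
    (hderiv : ∀ t ∈ Set.Ioo s b, HasDerivAt ψ (ψ' t) t)
    (hconv : ConvexOn ℝ (Set.Ioo s b) ψ') (hψs : ψ s = 0) (hψ0 : ψ 0 = 0) (hψ'0 : ψ' 0 = 0)
    {t : ℝ} (ht : t ∈ Set.Ico s b) : 0 ≤ ψ t := by
  -- Rolle gives a second zero `r` of the convex `ψ'`, so `ψ'` has signs `+, -, +` on the intervals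
  -- cut out by `r` and `0`. Thus `ψ` rises from `ψ s = 0`, falls to `ψ 0 = 0`, then rises again.
  obtain ⟨r, hr, hr0⟩ : ∃ r ∈ Set.Ioo s 0, ψ' r = 0 :=
    exists_hasDerivAt_eq_zero hs (hcont.mono (Set.Icc_subset_Ico_right hb)) (by rw [hψs, hψ0])
      fun x hx => hderiv x ⟨hx.1, hx.2.trans hb⟩
  have h0 : (0 : ℝ) ∈ Set.Ioo s b := ⟨hs, hb⟩
  have hrb : r ∈ Set.Ioo s b := ⟨hr.1, hr.2.trans hb⟩
  have hleft : ∀ x ∈ Set.Ioo s r, 0 ≤ ψ' x := by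
    intro x hx
    have := hconv.slope_mono_adjacent ⟨hx.1, hx.2.trans hrb.2⟩ h0 hx.2 hr.2
    rw [hr0, hψ'0, sub_self, zero_div, div_le_iff₀ (sub_pos.2 hx.2)] at this
    linarith
  have hmid : ∀ x ∈ Set.Ioo r 0, ψ' x ≤ 0 := by
    intro x hx
    have := hconv.slope_mono_adjacent hrb h0 hx.1 hx.2
    rw [hr0, hψ'0, div_le_div_iff₀ (sub_pos.2 hx.1) (by linarith [hx.2])] at this
    nlinarith [hr.2]
  have hright : ∀ x ∈ Set.Ioo 0 b, 0 ≤ ψ' x := by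
    intro x hx
    have := hconv.slope_mono_adjacent hrb ⟨hs.trans hx.1, hx.2⟩ hr.2 hx.1
    rw [hr0, hψ'0, sub_self, zero_div, le_div_iff₀ (by linarith [hx.1])] at this
    linarith
  rcases le_total t r with htr | htr
  · have hmono : MonotoneOn ψ (Set.Icc s r) := by
      refine monotoneOn_of_deriv_nonneg (convex_Icc s r)
        (hcont.mono (Set.Icc_subset_Ico_right hrb.2)) ?_ ?_ <;> rw [interior_Icc] <;> intro x hx
      · exact (hderiv x ⟨hx.1, hx.2.trans hrb.2⟩).differentiableAt.differentiableWithinAt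
      · rw [(hderiv x ⟨hx.1, hx.2.trans hrb.2⟩).deriv]
        exact hleft x hx
    rw [← hψs]
    exact hmono ⟨le_rfl, hr.1.le⟩ ⟨ht.1, htr⟩ ht.1
  rcases le_total t 0 with ht0 | ht0
  · have hanti : AntitoneOn ψ (Set.Icc r 0) := by
      refine antitoneOn_of_deriv_nonpos (convex_Icc r 0)
        (hcont.mono fun x hx => ⟨hr.1.le.trans hx.1, hx.2.trans_lt hb⟩) ?_ ?_ <;>
        rw [interior_Icc] <;> intro x hx
      · exact (hderiv x ⟨hr.1.trans hx.1, hx.2.trans hb⟩).differentiableAt.differentiableWithinAt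
      · rw [(hderiv x ⟨hr.1.trans hx.1, hx.2.trans hb⟩).deriv]
        exact hmid x hx
    rw [← hψ0]
    exact hanti ⟨htr, ht0⟩ ⟨hr.2.le, le_rfl⟩ ht0
  · have hmono : MonotoneOn ψ (Set.Ico 0 b) := by
      refine monotoneOn_of_deriv_nonneg (convex_Ico 0 b)
        (hcont.mono fun x hx => ⟨hs.le.trans hx.1, hx.2⟩) ?_ ?_ <;>
        rw [interior_Ico] <;> intro x hx
      · exact (hderiv x ⟨hs.trans hx.1, hx.2⟩).differentiableAt.differentiableWithinAt
      · rw [(hderiv x ⟨hs.trans hx.1, hx.2⟩).deriv]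
        exact hright x hx
    rw [← hψ0]
    exact hmono ⟨le_rfl, hb⟩ ⟨ht0, ht.2⟩ ht0

/-- The quadratic Hermite interpolant of an absolutely monotone function at a node `s < 0` and
the double node `0` stays below the function to the right of `s`. -/
theorem exists_quadratic_le_of_absolutelyMonotoneOn {g : ℝ → ℝ}
    (hg : AbsolutelyMonotoneOn g (Set.Ico (-1) 1)) {s : ℝ} (hs : -1 ≤ s) (hs0 : s < 0) :
    ∃ b c : ℝ, g s = g 0 + b * s + c * s ^ 2 ∧
      ∀ t ∈ Set.Ico s 1, g 0 + b * t + c * t ^ 2 ≤ g t := by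
  have hsub : Set.Ioo s 1 ⊆ Set.Ico (-1 : ℝ) 1 := fun x hx => ⟨hs.trans hx.1.le, hx.2⟩
  have hg' := absolutelyMonotoneOn_mono hg hsub
  -- Tangency at `0` forces `b`; the value at `s` then forces `c`.
  set b := deriv g 0 with hb
  set c := (g s - g 0 - b * s) / s ^ 2 with hc
  have hcs : c * s ^ 2 = g s - g 0 - b * s := div_mul_cancel₀ _ (pow_ne_zero 2 hs0.ne)
  refine ⟨b, c, by linarith, fun t ht => ?_⟩
  -- Subtracting the derivative of a quadratic changes `g'` by an affine function, so convexity
  -- survives.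
  have hconv : ConvexOn ℝ (Set.Ioo s 1) fun x => deriv g x + (-b - 2 * c * x) := by
    refine (convexOn_deriv_of_absolutelyMonotoneOn hg').add ⟨convex_Ioo s 1, ?_⟩
    intro x _ y _ α β _ _ hαβ
    simp only [smul_eq_mul]
    apply le_of_eq
    linear_combination b * hαβ
  have key := nonneg_of_convexOn_deriv (ψ := fun x => g x - (g 0 + b * x + c * x ^ 2))
    (ψ' := fun x => deriv g x + (-b - 2 * c * x)) hs0 one_pos ?_ ?_ hconv
    (by linarith) (by simp) (by simp [hb]) ht
  · linarith [key]
  · exact (hg.contDiffOn.continuousOn.mono fun x hx => ⟨hs.trans hx.1, hx.2⟩).sub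
      (by fun_prop)
  · intro x hx
    have h1 : HasDerivAt g (deriv g x) x :=
      ((hg'.contDiffOn.differentiableOn (by simp)).differentiableAt
        (isOpen_Ioo.mem_nhds hx)).hasDerivAt
    have h2 : HasDerivAt (fun x : ℝ => g 0 + b * x + c * x ^ 2) (b + 2 * c * x) x := by
      have := (((hasDerivAt_id x).const_mul b).const_add (g 0)).add
        ((hasDerivAt_pow 2 x).const_mul c)
      exact this.congr_deriv (by simp; ring)
    exact (h1.sub h2).congr_deriv (by ring)

end SphericalEnergy

/-! ### Moments of the sphere and of spherical 2-designs. -/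

namespace SphericalEnergy

open MeasureTheory
open scoped Pointwise

/-- The action of a linear isometry on the unit sphere. -/
noncomputable def sphereMap {n : ℕ} (e : EuclideanSpace ℝ (Fin n) ≃ₗᵢ[ℝ] EuclideanSpace ℝ (Fin n))
    (x : UnitSphere n) : UnitSphere n :=
  ⟨e x, by simp⟩

/-- Surface measure is, up to a constant, the volume of the cone over a set; isometries commute with
taking cones and preserve volume. -/
theorem measurePreserving_sphereMap {n : ℕ}
    (e : EuclideanSpace ℝ (Fin n) ≃ₗᵢ[ℝ] EuclideanSpace ℝ (Fin n)) :
    MeasurePreserving (sphereMap e) (surfaceMeasure n) (surfaceMeasure n) := by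
  have hcont : Continuous (sphereMap e) :=
    (e.continuous.comp continuous_subtype_val).subtype_mk _
  refine ⟨hcont.measurable, Measure.ext fun s hs => ?_⟩
  rw [Measure.map_apply hcont.measurable hs, surfaceMeasure,
    Measure.toSphere_apply' _ (hcont.measurable hs), Measure.toSphere_apply' _ hs]
  congr 1
  have himage : Set.Ioo (0 : ℝ) 1 • ((↑) '' (sphereMap e ⁻¹' s) : Set (EuclideanSpace ℝ (Fin n)))
      = e ⁻¹' (Set.Ioo (0 : ℝ) 1 • ((↑) '' s)) := by
    ext z
    simp only [Set.mem_smul, Set.mem_image, Set.mem_preimage]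
    constructor
    · rintro ⟨r, hr, _, ⟨x, hx, rfl⟩, rfl⟩
      exact ⟨r, hr, _, ⟨_, hx, rfl⟩, by simp [sphereMap]⟩
    · rintro ⟨r, hr, _, ⟨x, hx, rfl⟩, hz⟩
      refine ⟨r, hr, _, ⟨sphereMap e.symm x, ?_, rfl⟩, ?_⟩
      · convert hx
        simp [sphereMap]
      · simp only [sphereMap]
        rw [← map_smul, hz, e.symm_apply_apply]
  rw [himage]
  exact e.measurePreserving.measure_preimage_equiv (f := e.toMeasurableEquiv) _

theorem integral_comp_sphereMap {n : ℕ}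
    (e : EuclideanSpace ℝ (Fin n) ≃ₗᵢ[ℝ] EuclideanSpace ℝ (Fin n)) {f : UnitSphere n → ℝ}
    (hf : Continuous f) :
    ∫ x, f (sphereMap e x) ∂surfaceMeasure n = ∫ x, f x ∂surfaceMeasure n := by
  have hmp := measurePreserving_sphereMap e
  have := integral_map (μ := surfaceMeasure n) hmp.measurable.aemeasurable
    (hf.aestronglyMeasurable (μ := (surfaceMeasure n).map (sphereMap e)))
  rw [← this, hmp.map_eq]

instance {n : ℕ} : IsFiniteMeasure (surfaceMeasure n) := by
  unfold surfaceMeasure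
  infer_instance

theorem surfaceMeasure_real_univ_ne_zero {n : ℕ} (hn : n ≠ 0) :
    (surfaceMeasure n).real Set.univ ≠ 0 := by
  have : Nonempty (Fin n) := ⟨⟨0, Nat.pos_of_ne_zero hn⟩⟩
  have : NeZero (surfaceMeasure n) := ⟨Measure.toSphere_ne_zero _⟩
  exact measureReal_univ_ne_zero

theorem integrable_of_continuous {n : ℕ} {f : UnitSphere n → ℝ} (hf : Continuous f) :
    Integrable f (surfaceMeasure n) :=
  hf.integrable_of_hasCompactSupport (HasCompactSupport.of_compactSpace f)

/-- The integrand is odd under the antipodal map. -/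
theorem integral_inner_eq_zero {n : ℕ} (u : EuclideanSpace ℝ (Fin n)) :
    ∫ x : UnitSphere n, inner ℝ (x : EuclideanSpace ℝ (Fin n)) u ∂surfaceMeasure n = 0 := by
  have := integral_comp_sphereMap (n := n) (LinearIsometryEquiv.neg ℝ)
    (f := fun x => inner ℝ (x : EuclideanSpace ℝ (Fin n)) u) (by fun_prop)
  simp only [sphereMap, LinearIsometryEquiv.coe_neg, inner_neg_left, integral_neg] at this
  linarith

/-- The reflection in the hyperplane orthogonal to `u - v` carries `u` to `v`. -/
theorem integral_inner_sq_eq_of_norm_eq {n : ℕ} {u v : EuclideanSpace ℝ (Fin n)}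
    (huv : ‖u‖ = ‖v‖) :
    ∫ x : UnitSphere n, inner ℝ (x : EuclideanSpace ℝ (Fin n)) u ^ 2 ∂surfaceMeasure n
      = ∫ x : UnitSphere n, inner ℝ (x : EuclideanSpace ℝ (Fin n)) v ^ 2 ∂surfaceMeasure n := by
  set e := (ℝ ∙ (u - v))ᗮ.reflection
  have he : e u = v := Submodule.reflection_sub huv
  rw [← integral_comp_sphereMap e
    (f := fun x => inner ℝ (x : EuclideanSpace ℝ (Fin n)) v ^ 2) (by fun_prop)]
  simp only [sphereMap, ← he, LinearIsometryEquiv.inner_map_map]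

/-- The vectors `‖u‖ eᵢ` all have the norm of `u`, so their `n` integrals equal that of `u`, while
the integrands add up to the constant `‖u‖²`. -/
theorem integral_inner_sq {n : ℕ} (hn : n ≠ 0) (u : EuclideanSpace ℝ (Fin n)) :
    ∫ x : UnitSphere n, inner ℝ (x : EuclideanSpace ℝ (Fin n)) u ^ 2 ∂surfaceMeasure n
      = ‖u‖ ^ 2 / n * (surfaceMeasure n).real Set.univ := by
  have hsum : ∀ x : UnitSphere n, ∑ i : Fin n, inner ℝ (x : EuclideanSpace ℝ (Fin n))
      (‖u‖ • EuclideanSpace.single i (1 : ℝ)) ^ 2 = ‖u‖ ^ 2 := by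
    intro x
    have hx : ‖(x : EuclideanSpace ℝ (Fin n))‖ = 1 := by simp
    have := EuclideanSpace.norm_sq_eq (x : EuclideanSpace ℝ (Fin n))
    simp only [hx, Real.norm_eq_abs, sq_abs] at this
    simp [inner_smul_right, mul_pow, EuclideanSpace.inner_single_right, ← Finset.mul_sum, ← this]
  have hint := congrArg (fun f : UnitSphere n → ℝ => ∫ x, f x ∂surfaceMeasure n) (funext hsum)
  simp only [integral_const, smul_eq_mul] at hint
  rw [integral_finsetSum _ fun i _ => integrable_of_continuous (by fun_prop)] at hint
  rw [Finset.sum_congr rfl fun i _ => integral_inner_sq_eq_of_norm_eq (v := u)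
    (by simp [norm_smul])] at hint
  simp only [Finset.sum_const, Finset.card_univ, Fintype.card_fin, nsmul_eq_mul] at hint
  have hn' : (n : ℝ) ≠ 0 := Nat.cast_ne_zero.2 hn
  field_simp
  linarith

/-- The linear form `⟨·, u⟩` as a polynomial. -/
noncomputable def linearForm {n : ℕ} (u : EuclideanSpace ℝ (Fin n)) : MvPolynomial (Fin n) ℝ :=
  ∑ i, MvPolynomial.C (u i) * MvPolynomial.X i

theorem totalDegree_linearForm_le {n : ℕ} (u : EuclideanSpace ℝ (Fin n)) :
    (linearForm u).totalDegree ≤ 1 :=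
  MvPolynomial.totalDegree_finsetSum_le fun i _ =>
    (MvPolynomial.totalDegree_mul _ _).trans (by simp)

theorem eval_linearForm {n : ℕ} (u x : EuclideanSpace ℝ (Fin n)) :
    MvPolynomial.eval (fun i => x i) (linearForm u) = inner ℝ x u := by
  simp [linearForm, PiLp.inner_apply]

theorem IsSphericalDesign.sum_inner_eq_zero {n : ℕ} {C : Finset (UnitSphere n)}
    (hC : IsSphericalDesign 2 C) (u : EuclideanSpace ℝ (Fin n)) :
    ∑ x ∈ C, inner ℝ (x : EuclideanSpace ℝ (Fin n)) u = 0 := by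
  have := hC (linearForm u) ((totalDegree_linearForm_le u).trans one_le_two)
  simp only [evalOn, eval_linearForm, integral_inner_eq_zero, mul_zero] at this
  rcases C.eq_empty_or_nonempty with rfl | hne
  · simp
  · exact (mul_eq_zero.1 this.symm).resolve_left
      (inv_ne_zero (Nat.cast_ne_zero.2 hne.card_pos.ne'))

theorem IsSphericalDesign.sum_inner_sq {n : ℕ} (hn : n ≠ 0) {C : Finset (UnitSphere n)}
    (hC : IsSphericalDesign 2 C) (u : EuclideanSpace ℝ (Fin n)) :
    ∑ x ∈ C, inner ℝ (x : EuclideanSpace ℝ (Fin n)) u ^ 2 = C.card / n * ‖u‖ ^ 2 := by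
  have := hC (linearForm u ^ 2) ((MvPolynomial.totalDegree_pow _ _).trans
    (by have := totalDegree_linearForm_le u; omega))
  simp only [evalOn, map_pow, eval_linearForm, integral_inner_sq hn] at this
  have hμ := surfaceMeasure_real_univ_ne_zero hn
  rcases C.eq_empty_or_nonempty with rfl | hne
  · simp
  · have hc : (C.card : ℝ) ≠ 0 := Nat.cast_ne_zero.2 hne.card_pos.ne'
    field_simp at this ⊢
    linarith

/-- Two distinct points of a spherical `2`-design have inner product at least `1 - |C| / n`. -/
theorem IsSphericalDesign.le_inner {n : ℕ} (hn : n ≠ 0) {C : Finset (UnitSphere n)}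
    (hC : IsSphericalDesign 2 C) {x y : UnitSphere n} (hx : x ∈ C) (hy : y ∈ C) (hxy : x ≠ y) :
    1 - (C.card : ℝ) / n ≤
      inner ℝ (x : EuclideanSpace ℝ (Fin n)) (y : EuclideanSpace ℝ (Fin n)) := by
  set t := inner ℝ (x : EuclideanSpace ℝ (Fin n)) (y : EuclideanSpace ℝ (Fin n)) with ht
  have ht1 : t < 1 := (inner_lt_one_iff_real_of_norm_eq_one (by simp) (by simp)).2
    fun h => hxy (Subtype.ext h)
  -- Test the second moment on `x - y`. The points `x` and `y` alone contribute `2(1-t)²`, and the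
  -- total is `(|C|/n)(2-2t)`; dividing by `1 - t > 0` gives the claim.
  have hsum := hC.sum_inner_sq hn ((x : EuclideanSpace ℝ (Fin n)) - y)
  have hpair : ∑ z ∈ {x, y}, inner ℝ (z : EuclideanSpace ℝ (Fin n))
      ((x : EuclideanSpace ℝ (Fin n)) - y) ^ 2 ≤ ∑ z ∈ C, inner ℝ (z : EuclideanSpace ℝ (Fin n))
      ((x : EuclideanSpace ℝ (Fin n)) - y) ^ 2 :=
    Finset.sum_le_sum_of_subset_of_nonneg (by simp [Finset.insert_subset_iff, hx, hy])
      fun _ _ _ => sq_nonneg _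
  rw [hsum, Finset.sum_pair hxy, norm_sub_sq_real] at hpair
  simp only [inner_sub_right, real_inner_self_eq_norm_sq, norm_eq_of_mem_sphere,
    real_inner_comm (x : EuclideanSpace ℝ (Fin n)) (y : EuclideanSpace ℝ (Fin n)), ← ht] at hpair
  nlinarith

end SphericalEnergy

/-! ### The energy bound. -/

namespace SphericalEnergy

/-- A quadratic polynomial of the inner products, summed over ordered pairs of distinct points of
a spherical `2`-design. -/
theorem IsSphericalDesign.sum_offDiag_quadratic {n : ℕ} (hn : n ≠ 0) {C : Finset (UnitSphere n)}
    (hC : IsSphericalDesign 2 C) (a b c : ℝ) [DecidableEq (UnitSphere n)] :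
    ∑ p ∈ C.offDiag, (a + b * inner ℝ (p.1 : EuclideanSpace ℝ (Fin n)) p.2
        + c * inner ℝ (p.1 : EuclideanSpace ℝ (Fin n)) p.2 ^ 2)
      = C.card * (a * (C.card - 1) - b + c * (C.card / n - 1)) := by
  set F : UnitSphere n × UnitSphere n → ℝ := fun p =>
    a + b * inner ℝ (p.1 : EuclideanSpace ℝ (Fin n)) p.2
      + c * inner ℝ (p.1 : EuclideanSpace ℝ (Fin n)) p.2 ^ 2
  have hall : ∑ p ∈ C ×ˢ C, F p = C.card * (a * C.card + c * (C.card / n)) := by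
    rw [Finset.sum_product_right]
    have hinner : ∀ y ∈ C, ∑ x ∈ C, F (x, y) = a * C.card + c * (C.card / n) := by
      intro y _
      simp only [F, Finset.sum_add_distrib, ← Finset.mul_sum, hC.sum_inner_eq_zero,
        hC.sum_inner_sq hn, Finset.sum_const, nsmul_eq_mul, norm_eq_of_mem_sphere]
      ring
    rw [Finset.sum_congr rfl hinner, Finset.sum_const, nsmul_eq_mul]
  have hdiag : ∑ p ∈ C.diag, F p = C.card * (a + b + c) := by
    rw [Finset.sum_diag]
    simp [F]
    ring
  have hsplit : ∑ p ∈ C.diag, F p + ∑ p ∈ C.offDiag, F p = ∑ p ∈ C ×ˢ C, F p := by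
    rw [← Finset.sum_union (Finset.disjoint_diag_offDiag C), Finset.diag_union_offDiag]
  linear_combination hsplit + hall - hdiag

/-- The lower bound for the `h`-energy of a spherical `2`-design. -/
theorem IsSphericalDesign.le_energy {n : ℕ} {h : ℝ → ℝ≥0∞} (hh : IsAbsolutelyMonotone h)
    {C : Finset (UnitSphere n)} (hC : IsSphericalDesign 2 C) (hn : n ≠ 0) (hN : n < C.card)
    (hN' : C.card ≤ 2 * n) :
    ENNReal.ofReal (((C.card : ℝ) * ((h 0).toReal * (C.card : ℝ) * ((C.card : ℝ) - n - 1)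
      + n * (h (1 - (C.card : ℝ) / n)).toReal)) / ((C.card : ℝ) - n)) ≤ energy h C := by
  classical
  have hn0 : (0 : ℝ) < n := Nat.cast_pos.2 (Nat.pos_of_ne_zero hn)
  have hNn : (n : ℝ) < C.card := Nat.cast_lt.2 hN
  have hN2 : (C.card : ℝ) ≤ 2 * n := by exact_mod_cast hN'
  have hs : -1 ≤ 1 - (C.card : ℝ) / n := by
    have := (div_le_iff₀ hn0).2 hN2
    linarith
  have hs0 : 1 - (C.card : ℝ) / n < 0 := by
    have := (one_lt_div hn0).2 hNn
    linarith
  obtain ⟨b, c, hbc, hle⟩ := exists_quadratic_le_of_absolutelyMonotoneOn hh.2 hs hs0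
  have hmem : ∀ p ∈ C.offDiag, inner ℝ (p.1 : EuclideanSpace ℝ (Fin n)) p.2 ∈
      Set.Ico (1 - (C.card : ℝ) / n) 1 := by
    intro p hp
    obtain ⟨h1, h2, h3⟩ := Finset.mem_offDiag.1 hp
    exact ⟨hC.le_inner hn h1 h2 h3, (inner_lt_one_iff_real_of_norm_eq_one (by simp) (by simp)).2
      fun heq => h3 (Subtype.ext heq)⟩
  have hfin : ∀ p ∈ C.offDiag, h (inner ℝ (p.1 : EuclideanSpace ℝ (Fin n)) p.2) ≠ ∞ :=
    fun p hp => hh.1 _ ⟨hs.trans (hmem p hp).1, (hmem p hp).2⟩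
  have henergy : energy h C = ∑ p ∈ C.offDiag,
      h (inner ℝ (p.1 : EuclideanSpace ℝ (Fin n)) p.2) := by
    unfold energy
    congr!
  rw [henergy]
  refine ENNReal.ofReal_le_of_le_toReal ?_
  rw [ENNReal.toReal_sum hfin]
  refine le_trans (le_of_eq ?_) (Finset.sum_le_sum fun p hp => hle _ (hmem p hp))
  -- Once `h(s)` is written through `b` and `c`, both sides are rational expressions and the bound
  -- is an identity.
  rw [hC.sum_offDiag_quadratic hn, hbc]
  have : (C.card : ℝ) - n ≠ 0 := by linarith
  field_simp
  ring

end SphericalEnergy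

theorem theorem4p2 (n N : ℕ) (hn : 2 ≤ n) (hN : n + 1 ≤ N) (hN' : N ≤ 2 * n)
    (h : ℝ → ℝ≥0∞) (hh : SphericalEnergy.IsAbsolutelyMonotone h) :
    (((N : ℝ) * ((h 0).toReal * (N : ℝ) * ((N : ℝ) - (n : ℝ) - 1)
          + (n : ℝ) * (h (1 - (N : ℝ) / (n : ℝ))).toReal) / ((N : ℝ) - (n : ℝ)) : ℝ) : EReal)
        ≤ (SphericalEnergy.minDesignEnergy n N 2 h : EReal) ∧
    ∀ ζ : ℝ, ζ = (N : ℝ) / (n : ℝ) →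
      (((h 0).toReal * (N : ℝ) ^ 2
          + (N : ℝ) * ((h (1 - ζ)).toReal - ζ * (h 0).toReal) / (ζ - 1) : ℝ) : EReal)
        ≤ (SphericalEnergy.minDesignEnergy n N 2 h : EReal) := by
  have hn0 : (n : ℝ) ≠ 0 := by positivity
  have hNn : (N : ℝ) - n ≠ 0 := sub_ne_zero.2 (Nat.cast_injective.ne (by omega))
  have key : (((N : ℝ) * ((h 0).toReal * (N : ℝ) * ((N : ℝ) - (n : ℝ) - 1)
          + (n : ℝ) * (h (1 - (N : ℝ) / (n : ℝ))).toReal) / ((N : ℝ) - (n : ℝ)) : ℝ) : EReal)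
        ≤ (SphericalEnergy.minDesignEnergy n N 2 h : EReal) := by
    -- A real number is at most its truncation at `0`, so the bound may be proved in `ℝ≥0∞`, design
    -- by design.
    refine le_trans ?_ (EReal.coe_ennreal_le_coe_ennreal_iff.2 (le_iInf₂ fun C hC => ?_) :
      ((ENNReal.ofReal ((N : ℝ) * ((h 0).toReal * (N : ℝ) * ((N : ℝ) - (n : ℝ) - 1)
        + (n : ℝ) * (h (1 - (N : ℝ) / (n : ℝ))).toReal) / ((N : ℝ) - (n : ℝ))) : ℝ≥0∞) : EReal)
        ≤ _)
    · rw [EReal.coe_ennreal_ofReal]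
      exact EReal.coe_le_coe_iff.2 (le_max_left _ _)
    · obtain ⟨rfl, hdes⟩ := hC
      exact hdes.le_energy hh (by omega) hN hN'
  refine ⟨key, ?_⟩
  rintro ζ rfl
  convert key using 2
  have hζ : (N : ℝ) / n - 1 ≠ 0 := by
    rw [div_sub_one hn0]
    exact div_ne_zero hNn hn0
  field_simp
  ring
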